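/- For real $a$ put $$M(a) := \frac{4}{\pi}\int_0^{\pi/2} \frac{x^2\,dx}{x^2+\ln^2(2e^{-a}\cos x)} .$$ Then $M$ is continuous at $a=\ln 2$ and real-analytic on each of the intervals $(0,\ln 2)$ and $(\ln 2,\infty)$. The one-sided limits $$M'(\ln 2^-)=\lim_{a\to \ln 2,\ a<\ln 2}M'(a),\qquad M'(\ln 2^+)=\lim_{a\to\ln 2,\ a>\ln 2}M'(a)$$ exist, are finite, and are the left and right derivatives of $M$ at $\ln 2$; and the derivative $M'$ has a jump of size $4$ at $a=\ln 2$: $$M'(\ln 2^-)-M'(\ln 2^+)=4 .$$ -/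

import Mathlib

open Set Filter Topology

/-- The integrand of `M`. -/
noncomputable def oloaIntegrand (a x : ℝ) : ℝ :=
  x ^ 2 / (x ^ 2 + Real.log (2 * Real.exp (-a) * Real.cos x) ^ 2)

/-- `M(a) = (4/π) ∫_0^{π/2} x² / (x² + ln²(2 e^{-a} cos x)) dx`. -/
noncomputable def oloaM (a : ℝ) : ℝ :=
  4 / Real.pi * ∫ x in (0 : ℝ)..(Real.pi / 2), oloaIntegrand a x

/-- The integral defining `M(a)` converges for every real `a`: its integrand is measurable and
bounded by `1`. -/
theorem oloaIntegrand_intervalIntegrable (a : ℝ) :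
    IntervalIntegrable (oloaIntegrand a) MeasureTheory.volume 0 (Real.pi / 2) := by
  have hm : Measurable (oloaIntegrand a) := by
    unfold oloaIntegrand
    fun_prop
  refine (intervalIntegrable_const (c := (1 : ℝ))).mono_fun' hm.aestronglyMeasurable ?_
  refine Eventually.of_forall fun x => ?_
  have h2 := sq_nonneg (Real.log (2 * Real.exp (-a) * Real.cos x))
  unfold oloaIntegrand
  beta_reduce
  rw [Real.norm_of_nonneg (by positivity)]
  exact div_le_one_of_le₀ (by linarith) (by positivity)

/-! For `0 < x < π/2`, `log (1 + e^{2ix}) = log (2 cos x) + ix`, so the integrand of `M` is `-Im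
F(x)` with `F = stripIntegrand a`. Integrate `F` around the rectangle with corners `0` and `π/2 +
iY` and let `Y → ∞`; the summand `1/a` in `F` makes the top side vanish in the limit. On the left
side `F` is purely imaginary, so that side drops out of the imaginary part of the identity; the
right side yields `regularPart`, which is analytic for all `a > 0`.

A pole requires `log (1 + e^{2iζ}) = a`. In the closed half-strip this happens only on the left
side, at `iy₀` with `1 + e^{-2y₀} = e^a`, and `y₀ > 0` exists exactly when `0 < a < log 2`. Lying on
the contour, the pole contributes half a residue, which is `polarPart`. Hence `M = regularPart`
above `log 2` (`oloaM_eq_of_gt`) and `M = regularPart + polarPart` below (`oloaM_eq_of_lt`). The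
jump is the derivative of `polarPart` at `log 2`, namely `4`. -/

/-! ### Analyticity of the regular part. -/

/-- The boundary value `-log (1 - e^{-2y})` of `-log (1 + e^{2iζ})` on the line `Re ζ = π/2`. -/
noncomputable def edgeLog (y : ℝ) : ℝ := -Real.log (1 - Real.exp (-2 * y))

/-- The regular part of `M`, obtained from the integral along the line `Re ζ = π/2`. -/
noncomputable def regularPart (a : ℝ) : ℝ :=
  2 * ∫ y in Ioi (0 : ℝ), (a⁻¹ - (a + edgeLog y)⁻¹)

theorem exp_neg_two_mul_lt_one {y : ℝ} (hy : 0 < y) : Real.exp (-2 * y) < 1 :=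
  by
  simpa using hy

theorem edgeLog_nonneg {y : ℝ} (hy : 0 < y) : 0 ≤ edgeLog y := by
  have h1 := exp_neg_two_mul_lt_one hy
  have h2 := Real.exp_pos (-2 * y)
  have := Real.log_nonpos (x := 1 - Real.exp (-2 * y)) (by linarith) (by linarith)
  unfold edgeLog
  linarith

theorem measurable_edgeLog : Measurable edgeLog := by
  unfold edgeLog
  fun_prop

/-- `edgeLog` blows up as `y → 0`, so it is not itself bounded by a multiple of `e^{-2y}`; the extra
factor repairs this. The source is `log u ≥ 1 - 1/u`. -/
theorem edgeLog_mul_le {y : ℝ} (hy : 0 < y) :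
    edgeLog y * (1 - Real.exp (-2 * y)) ≤ Real.exp (-2 * y) := by
  have h1 : 0 < 1 - Real.exp (-2 * y) := by linarith [exp_neg_two_mul_lt_one hy]
  have h2 := Real.one_sub_inv_le_log_of_pos h1
  have h3 : edgeLog y ≤ (1 - Real.exp (-2 * y))⁻¹ - 1 := by unfold edgeLog; linarith
  calc _ ≤ ((1 - Real.exp (-2 * y))⁻¹ - 1) * (1 - Real.exp (-2 * y)) := by gcongr
    _ = _ := by rw [sub_mul, inv_mul_cancel₀ h1.ne']; ring

theorem inv_sub_inv_add_edgeLog_le {d y : ℝ} (hd : 0 < d) (hy : 0 < y) :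
    d⁻¹ - (d + edgeLog y)⁻¹ ≤ d⁻¹ * (1 + d⁻¹) * Real.exp (-2 * y) := by
  have h0 := edgeLog_nonneg hy
  have h1 := edgeLog_mul_le hy
  have ht := Real.exp_pos (-2 * y)
  set l := edgeLog y
  set t := Real.exp (-2 * y)
  have e1 : d⁻¹ - (d + l)⁻¹ = (d * l) / (d ^ 2 * (d + l)) := by field_simp; ring
  have e2 : d⁻¹ * (1 + d⁻¹) * t = ((d + 1) * t * (d + l)) / (d ^ 2 * (d + l)) := by field_simp
  rw [e1, e2]
  refine (div_le_div_iff_of_pos_right (by positivity)).2 ?_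
  nlinarith [mul_pos hd ht, mul_nonneg h0 ht.le, mul_pos (mul_pos hd ht) hd]

theorem inv_sub_inv_add_edgeLog_nonneg {d y : ℝ} (hd : 0 < d) (hy : 0 < y) :
    0 ≤ d⁻¹ - (d + edgeLog y)⁻¹ := by
  have h0 := edgeLog_nonneg hy
  have : (d + edgeLog y)⁻¹ ≤ d⁻¹ := inv_anti₀ hd (by linarith)
  linarith

theorem integrableOn_inv_sub_inv_add_edgeLog {d : ℝ} (hd : 0 < d) :
    MeasureTheory.IntegrableOn (fun y => d⁻¹ - (d + edgeLog y)⁻¹) (Ioi 0) := by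
  have hm := measurable_edgeLog
  refine ((exp_neg_integrableOn_Ioi 0 two_pos).const_mul (d⁻¹ * (1 + d⁻¹))).mono'
    (by fun_prop) ?_
  filter_upwards [MeasureTheory.ae_restrict_mem measurableSet_Ioi] with y hy
  rw [Real.norm_of_nonneg (inv_sub_inv_add_edgeLog_nonneg hd hy)]
  exact inv_sub_inv_add_edgeLog_le hd hy

theorem le_norm_of_le_re {d : ℝ} {s : ℂ} (h : d ≤ s.re) : d ≤ ‖s‖ :=
  h.trans (Complex.re_le_norm s)

theorem ne_zero_of_re_pos {s : ℂ} (h : 0 < s.re) : s ≠ 0 := by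
  rintro rfl
  simp at h

theorem norm_inv_sub_inv_add_le {d l : ℝ} {s : ℂ} (hd : 0 < d) (hl : 0 ≤ l) (hs : d ≤ s.re) :
    ‖s⁻¹ - (s + l)⁻¹‖ ≤ d⁻¹ - (d + l)⁻¹ := by
  have hs0 : s ≠ 0 := ne_zero_of_re_pos (by linarith)
  have hsl : s + l ≠ 0 := ne_zero_of_re_pos (by simp; linarith)
  have e1 : s⁻¹ - (s + l)⁻¹ = l / (s * (s + l)) := by field_simp; ring
  have e2 : d⁻¹ - (d + l)⁻¹ = l / (d * (d + l)) := by field_simp; ring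
  rw [e1, e2, norm_div, norm_mul, Complex.norm_real, Real.norm_of_nonneg hl]
  gcongr
  · exact le_norm_of_le_re hs
  · exact le_norm_of_le_re (by simpa using hs)

theorem norm_neg_inv_sq_add_inv_sq_le {d l : ℝ} {s : ℂ} (hd : 0 < d) (hl : 0 ≤ l)
    (hs : d ≤ s.re) :
    ‖-(s ^ 2)⁻¹ + ((s + l) ^ 2)⁻¹‖ ≤ 2 * d⁻¹ * (d⁻¹ - (d + l)⁻¹) := by
  have e : -(s ^ 2)⁻¹ + ((s + l) ^ 2)⁻¹ = -((s⁻¹ + (s + l)⁻¹) * (s⁻¹ - (s + l)⁻¹)) := by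
    rw [← inv_pow, ← inv_pow]
    ring
  rw [e, norm_neg, norm_mul]
  have h1 : ‖s⁻¹‖ ≤ d⁻¹ := by
    rw [norm_inv]
    exact inv_anti₀ hd (le_norm_of_le_re hs)
  have h2 : ‖(s + l)⁻¹‖ ≤ d⁻¹ := by
    rw [norm_inv]
    exact inv_anti₀ hd (le_norm_of_le_re (by simp; linarith))
  gcongr
  · calc _ ≤ _ := norm_add_le _ _
      _ ≤ _ := by linarith
  · exact norm_inv_sub_inv_add_le hd hl hs

/-- Complexifying `a` reduces real-analyticity to a single differentiation under the integral,
dominated uniformly on `Re s > Re s₀ / 2`. -/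
theorem differentiableAt_integral_inv_sub_inv_add_edgeLog {s₀ : ℂ} (hs₀ : 0 < s₀.re) :
    DifferentiableAt ℂ (fun s : ℂ => ∫ y in Ioi (0 : ℝ), (s⁻¹ - (s + edgeLog y)⁻¹)) s₀ := by
  have hm := measurable_edgeLog
  have hd : 0 < s₀.re / 2 := by positivity
  have hU : {s : ℂ | s₀.re / 2 < s.re} ∈ 𝓝 s₀ :=
    (isOpen_lt continuous_const Complex.continuous_re).mem_nhds (by simp; linarith)
  have hae := MeasureTheory.ae_restrict_mem (μ := MeasureTheory.volume)
    (measurableSet_Ioi (a := (0 : ℝ)))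
  have hint := integrableOn_inv_sub_inv_add_edgeLog hd
  refine (hasDerivAt_integral_of_dominated_loc_of_deriv_le
    (F' := fun s y => -(s ^ 2)⁻¹ + ((s + edgeLog y) ^ 2)⁻¹)
    (bound := fun y => 2 * (s₀.re / 2)⁻¹ * ((s₀.re / 2)⁻¹ - (s₀.re / 2 + edgeLog y)⁻¹))
    hU ?_ ?_ ?_ ?_ ?_ ?_).2.differentiableAt
  · exact Eventually.of_forall fun s => by fun_prop
  · refine hint.mono' (by fun_prop) ?_
    filter_upwards [hae] with y hy
    exact norm_inv_sub_inv_add_le hd (edgeLog_nonneg hy) (by linarith)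
  · fun_prop
  · filter_upwards [hae] with y hy s hs
    exact norm_neg_inv_sq_add_inv_sq_le hd (edgeLog_nonneg hy) (le_of_lt hs)
  · exact hint.const_mul _
  · filter_upwards [hae] with y hy s hs
    have hs : s₀.re / 2 < s.re := hs
    have hl := edgeLog_nonneg hy
    have hs0 : s ≠ 0 := ne_zero_of_re_pos (by linarith)
    have hsl : s + edgeLog y ≠ 0 := ne_zero_of_re_pos (by simp; linarith)
    have h1 := hasDerivAt_inv hs0
    have h2 := (hasDerivAt_inv hsl).comp_add_const s (edgeLog y : ℂ)
    exact (h1.fun_sub h2).congr_deriv (by ring)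

theorem analyticAt_regularPart {a : ℝ} (ha : 0 < a) : AnalyticAt ℝ regularPart a := by
  have hU : {s : ℂ | 0 < s.re} ∈ 𝓝 (a : ℂ) :=
    (isOpen_lt continuous_const Complex.continuous_re).mem_nhds (by simpa using ha)
  have h : AnalyticAt ℂ
      (fun s : ℂ => ∫ y in Ioi (0 : ℝ), (s⁻¹ - (s + edgeLog y)⁻¹)) (a : ℂ) :=
    DifferentiableOn.analyticAt (fun s hs =>
      (differentiableAt_integral_inv_sub_inv_add_edgeLog hs).differentiableWithinAt) hU
  refine ((analyticAt_const (v := (2 : ℝ))).mul h.re_ofReal).congr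
    (Eventually.of_forall fun t => ?_)
  have e : ∀ y : ℝ, (t : ℂ)⁻¹ - ((t : ℂ) + (edgeLog y : ℂ))⁻¹ =
      ((t⁻¹ - (t + edgeLog y)⁻¹ : ℝ) : ℂ) := by
    intro y
    push_cast
    rfl
  simp only [e, integral_complex_ofReal, Complex.ofReal_re, regularPart, Pi.mul_apply]

/-! ### Continuity of `M`. -/

theorem continuous_oloaM : Continuous oloaM := by
  refine continuous_const.mul (continuous_iff_continuousAt.2 fun a => ?_)
  refine intervalIntegral.continuousAt_of_dominated_interval (bound := fun _ => 1)
    (Eventually.of_forall fun b => ?_) (Eventually.of_forall fun b => ?_)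
    intervalIntegrable_const ?_
  · have hm : Measurable (oloaIntegrand b) := by
      unfold oloaIntegrand
      fun_prop
    exact hm.aestronglyMeasurable
  · refine Eventually.of_forall fun x _ => ?_
    have h2 := sq_nonneg (Real.log (2 * Real.exp (-b) * Real.cos x))
    unfold oloaIntegrand
    rw [Real.norm_of_nonneg (by positivity)]
    exact div_le_one_of_le₀ (by linarith) (by positivity)
  · have h := (MeasureTheory.Measure.ae_ne MeasureTheory.volume (Real.pi / 2))
    filter_upwards [h] with x hx hx'
    rw [uIoc_of_le (by positivity)] at hx'
    have hc : 0 < Real.cos x := Real.cos_pos_of_mem_Ioo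
      ⟨by linarith [hx'.1, Real.pi_pos], lt_of_le_of_ne hx'.2 hx⟩
    have hx2 := hx'.1
    unfold oloaIntegrand
    refine ContinuousAt.div continuousAt_const ?_ (by positivity)
    refine continuousAt_const.add (ContinuousAt.pow (ContinuousAt.log ?_ (by positivity)) 2)
    fun_prop

/-! ### The contour integrand: poles, continuity, boundary values, decay. -/

/-- The function `1 + e^{2iζ}`. -/
noncomputable def stripFun (ζ : ℂ) : ℂ := 1 + Complex.exp (2 * Complex.I * ζ)

/-- The function `1 / (log w - a)`, extended continuously by `0` to `w = 0`. -/
noncomputable def logResolvent (a : ℝ) (w : ℂ) : ℂ := if w = 0 then 0 else (Complex.log w - a)⁻¹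

/-- The contour integrand `ζ (1 / (log (1 + e^{2iζ}) - a) + 1 / a)`. -/
noncomputable def stripIntegrand (a : ℝ) (ζ : ℂ) : ℂ :=
  ζ * (logResolvent a (stripFun ζ) + (a : ℂ)⁻¹)

theorem stripFun_re (ζ : ℂ) :
    (stripFun ζ).re = 1 + Real.exp (-2 * ζ.im) * Real.cos (2 * ζ.re) := by
  simp [stripFun, Complex.exp_re]

theorem stripFun_im (ζ : ℂ) :
    (stripFun ζ).im = Real.exp (-2 * ζ.im) * Real.sin (2 * ζ.re) := by
  simp [stripFun, Complex.exp_im]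

theorem differentiable_stripFun : Differentiable ℂ stripFun := by
  unfold stripFun
  fun_prop

theorem stripFun_im_pos {ζ : ℂ} (h0 : 0 < ζ.re) (h1 : ζ.re < Real.pi / 2) :
    0 < (stripFun ζ).im := by
  rw [stripFun_im]
  exact mul_pos (Real.exp_pos _) (Real.sin_pos_of_pos_of_lt_pi (by linarith) (by linarith))

theorem stripFun_mul_I (y : ℝ) :
    stripFun (y * Complex.I) = ((1 + Real.exp (-2 * y) : ℝ) : ℂ) := by
  apply Complex.ext <;> simp [stripFun_re, stripFun_im, Complex.exp_re, Complex.exp_im]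

theorem stripFun_half_pi_add_mul_I (y : ℝ) :
    stripFun ((Real.pi / 2 : ℝ) + y * Complex.I) = ((1 - Real.exp (-2 * y) : ℝ) : ℂ) := by
  have h : 2 * (Real.pi / 2) = Real.pi := by ring
  apply Complex.ext <;> simp [stripFun_re, stripFun_im, h, sub_eq_add_neg, Complex.exp_re,
    Complex.exp_im]

theorem stripFun_ofReal {x : ℝ} (h0 : 0 < x) (h1 : x < Real.pi / 2) :
    Complex.log (stripFun x) = (Real.log (2 * Real.cos x) : ℝ) + x * Complex.I := by
  have hc : 0 < Real.cos x := Real.cos_pos_of_mem_Ioo ⟨by linarith [Real.pi_pos], h1⟩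
  have e : stripFun x = Complex.exp ((Real.log (2 * Real.cos x) : ℝ) + x * Complex.I) := by
    have hr : Real.exp (Real.log (2 * Real.cos x)) = 2 * Real.cos x :=
      Real.exp_log (by positivity)
    apply Complex.ext
    · simp only [stripFun_re, Complex.exp_re, Complex.ofReal_re, Complex.ofReal_im,
        Complex.add_re, Complex.add_im, Complex.mul_re, Complex.mul_im, Complex.I_re, Complex.I_im,
        mul_zero, mul_one, sub_zero, add_zero, zero_add, hr, Real.cos_two_mul, Real.exp_zero]
      ring
    · simp only [stripFun_im, Complex.exp_im, Complex.ofReal_re, Complex.ofReal_im,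
        Complex.add_re, Complex.add_im, Complex.mul_re, Complex.mul_im, Complex.I_re, Complex.I_im,
        mul_zero, mul_one, sub_zero, add_zero, zero_add, hr, Real.sin_two_mul, Real.exp_zero]
      ring
  rw [e, Complex.log_exp] <;> simp <;> linarith

theorem stripFun_mem_slitPlane {ζ : ℂ} (h0 : 0 ≤ ζ.re) (h1 : ζ.re ≤ Real.pi / 2) (h2 : 0 ≤ ζ.im)
    (hζ : ζ ≠ (Real.pi / 2 : ℝ)) : stripFun ζ ∈ Complex.slitPlane := by
  rcases h0.eq_or_lt with h0 | h0
  · left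
    rw [stripFun_re, ← h0]
    simp
    positivity
  rcases h1.eq_or_lt with h1 | h1
  · left
    have h2 : 0 < ζ.im := by
      refine h2.lt_of_ne fun h => hζ (Complex.ext ?_ ?_) <;> simp [h1, ← h]
    have h3 := exp_neg_two_mul_lt_one h2
    rw [stripFun_re, h1, mul_div_cancel₀ _ two_ne_zero, Real.cos_pi]
    linarith
  · exact Or.inr (stripFun_im_pos h0 h1).ne'

theorem log_stripFun_ne_of_re_pos {a : ℝ} (ha : 0 < a) {ζ : ℂ} (h0 : 0 < ζ.re)
    (h1 : ζ.re ≤ Real.pi / 2) (h2 : 0 ≤ ζ.im) : Complex.log (stripFun ζ) ≠ a := by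
  intro h
  rcases h1.eq_or_lt with h1 | h1
  · have e : ζ = (Real.pi / 2 : ℝ) + ζ.im * Complex.I := by
      apply Complex.ext <;> simp [h1]
    have h3 : Real.exp (-2 * ζ.im) ≤ 1 := by simpa using h2
    rw [e, stripFun_half_pi_add_mul_I, ← Complex.ofReal_log (by linarith), Complex.ofReal_inj] at h
    -- At the corner `π/2` the convention `log 0 = 0` is still covered by this bound.
    have := Real.log_nonpos (x := 1 - Real.exp (-2 * ζ.im)) (by linarith)
      (by linarith [Real.exp_pos (-2 * ζ.im)])
    linarith
  · have h3 := congrArg Complex.im h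
    rw [Complex.log_im, Complex.ofReal_im, Complex.arg_eq_zero_iff] at h3
    exact (stripFun_im_pos h0 h1).ne' h3.2

theorem log_stripFun_ne {a : ℝ} (ha : 0 < a) {ζ : ℂ} (h0 : 0 ≤ ζ.re) (h1 : ζ.re ≤ Real.pi / 2)
    (h2 : 0 ≤ ζ.im) (h : Real.log (1 + Real.exp (-2 * ζ.im)) ≠ a) :
    Complex.log (stripFun ζ) ≠ a := by
  rcases h0.eq_or_lt with h0 | h0
  · have e : ζ = ζ.im * Complex.I := by
      apply Complex.ext <;> simp [← h0]
    rw [e, stripFun_mul_I, ← Complex.ofReal_log (by positivity)]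
    exact_mod_cast h
  · exact log_stripFun_ne_of_re_pos ha h0 h1 h2

/-- `|log w| → ∞` as `w → 0`. The corner `π/2` is sent to `w = 0`, where the convention `log 0 = 0`
would give `-1/a` instead of the limit `0`. -/
theorem continuousAt_logResolvent_zero (a : ℝ) : ContinuousAt (logResolvent a) 0 := by
  rw [continuousAt_iff_punctured_nhds]
  have e : logResolvent a 0 = 0 := by simp [logResolvent]
  rw [e]
  have h1 : Tendsto (fun w : ℂ => Complex.log w - a) (𝓝[≠] 0) (Bornology.cobounded ℂ) := by
    rw [← tendsto_norm_atTop_iff_cobounded]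
    have h2 : Tendsto (fun w : ℂ => -Real.log ‖w‖ + a) (𝓝[≠] 0) atTop :=
      tendsto_atTop_add_const_right _ _ (tendsto_neg_atBot_atTop.comp
        (Real.tendsto_log_nhdsGT_zero.comp tendsto_norm_nhdsNE_zero))
    refine tendsto_atTop_mono (fun w => ?_) h2
    have := Complex.abs_re_le_norm (Complex.log w - a)
    rw [Complex.sub_re, Complex.log_re, Complex.ofReal_re] at this
    linarith [neg_abs_le (Real.log ‖w‖ - a)]
  refine (tendsto_inv₀_cobounded.comp h1).congr' ?_
  filter_upwards [self_mem_nhdsWithin] with w hw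
  have hw : w ≠ 0 := hw
  simp [logResolvent, hw]

theorem differentiableAt_logResolvent {a : ℝ} {w : ℂ} (hw : w ∈ Complex.slitPlane)
    (h : Complex.log w ≠ a) : DifferentiableAt ℂ (logResolvent a) w := by
  have h1 : DifferentiableAt ℂ (fun w : ℂ => (Complex.log w - a)⁻¹) w :=
    ((Complex.differentiableAt_log hw).sub_const _).inv (sub_ne_zero.2 h)
  refine h1.congr_of_eventuallyEq ?_
  filter_upwards [isOpen_ne.mem_nhds (Complex.slitPlane_ne_zero hw)] with v hv
  have hv : v ≠ 0 := hv
  simp [logResolvent, hv]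

theorem stripFun_half_pi : stripFun (Real.pi / 2 : ℝ) = 0 := by
  simpa using stripFun_half_pi_add_mul_I 0

theorem differentiableAt_stripIntegrand {a : ℝ} {ζ : ℂ} (hw : stripFun ζ ∈ Complex.slitPlane)
    (h : Complex.log (stripFun ζ) ≠ a) : DifferentiableAt ℂ (stripIntegrand a) ζ := by
  have h1 := (differentiableAt_logResolvent hw h).comp ζ (differentiable_stripFun ζ)
  exact differentiableAt_id.mul (h1.add_const _)

theorem continuousAt_stripIntegrand {a : ℝ} (ha : 0 < a) {ζ : ℂ} (h0 : 0 ≤ ζ.re)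
    (h1 : ζ.re ≤ Real.pi / 2) (h2 : 0 ≤ ζ.im)
    (h : Real.log (1 + Real.exp (-2 * ζ.im)) ≠ a ∨ 0 < ζ.re) :
    ContinuousAt (stripIntegrand a) ζ := by
  by_cases hζ : ζ = (Real.pi / 2 : ℝ)
  · have h3 : ContinuousAt (logResolvent a) (stripFun ζ) := by
      rw [hζ, stripFun_half_pi]
      exact continuousAt_logResolvent_zero a
    exact continuousAt_id.mul
      ((ContinuousAt.comp h3 differentiable_stripFun.continuous.continuousAt).add
        continuousAt_const)
  · refine (differentiableAt_stripIntegrand (stripFun_mem_slitPlane h0 h1 h2 hζ) ?_).continuousAt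
    rcases h with h | h
    · exact log_stripFun_ne ha h0 h1 h2 h
    · exact log_stripFun_ne_of_re_pos ha h h1 h2

theorem stripIntegrand_ofReal_im {a x : ℝ} (h0 : 0 < x) (h1 : x < Real.pi / 2) :
    (stripIntegrand a x).im = -oloaIntegrand a x := by
  have hc : 0 < Real.cos x := Real.cos_pos_of_mem_Ioo ⟨by linarith [Real.pi_pos], h1⟩
  have hw : stripFun x ≠ 0 := by
    intro h
    have := stripFun_im_pos (ζ := x) (by simpa using h0) (by simpa using h1)
    simp [h] at this
  have hl : Real.log (2 * Real.exp (-a) * Real.cos x) = Real.log (2 * Real.cos x) - a := by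
    rw [mul_right_comm, Real.log_mul (by positivity) (by positivity), Real.log_exp]
    ring
  rw [stripIntegrand, logResolvent, if_neg hw, stripFun_ofReal h0 h1, oloaIntegrand, hl,
    Complex.im_ofReal_mul, Complex.add_im, ← Complex.ofReal_inv, Complex.ofReal_im, Complex.inv_im,
    Complex.normSq_apply]
  simp only [Complex.sub_re, Complex.sub_im, Complex.add_re, Complex.add_im, Complex.ofReal_re,
    Complex.ofReal_im, Complex.mul_re, Complex.mul_im, Complex.I_re, Complex.I_im]
  ring

theorem stripIntegrand_mul_I_re (a y : ℝ) : (stripIntegrand a (y * Complex.I)).re = 0 := by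
  have hp : 0 < 1 + Real.exp (-2 * y) := by positivity
  rw [stripIntegrand, logResolvent, stripFun_mul_I, if_neg (by exact_mod_cast hp.ne'),
    ← Complex.ofReal_log hp.le, ← Complex.ofReal_sub, ← Complex.ofReal_inv, ← Complex.ofReal_inv,
    ← Complex.ofReal_add]
  simp

theorem stripIntegrand_half_pi_add_mul_I_re (a : ℝ) {y : ℝ} (hy : 0 < y) :
    (stripIntegrand a ((Real.pi / 2 : ℝ) + y * Complex.I)).re =
      Real.pi / 2 * (a⁻¹ - (a + edgeLog y)⁻¹) := by
  have hp : 0 < 1 - Real.exp (-2 * y) := by linarith [exp_neg_two_mul_lt_one hy]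
  have e : Real.log (1 - Real.exp (-2 * y)) - a = -(a + edgeLog y) := by
    unfold edgeLog
    ring
  rw [stripIntegrand, logResolvent, stripFun_half_pi_add_mul_I,
    if_neg (by exact_mod_cast hp.ne'),
    ← Complex.ofReal_log hp.le, ← Complex.ofReal_sub, ← Complex.ofReal_inv, ← Complex.ofReal_inv,
    ← Complex.ofReal_add, Complex.re_mul_ofReal, e, inv_neg]
  simp
  ring

/-- Adding `1/a` leaves `log (1 + z) / ((log (1 + z) - a) a)` with `z = e^{2iζ}`. The `3` is `3/2`,
from `|log (1 + z)| ≤ 3/2 |z|`, divided by `1/2`, from `|log (1 + z) - a| ≥ a/2`. -/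
theorem norm_stripIntegrand_le {a : ℝ} (ha : 0 < a) {ζ : ℂ} (h1 : 1 ≤ ζ.im)
    (h2 : 3 * Real.exp (-2 * ζ.im) ≤ a) :
    ‖stripIntegrand a ζ‖ ≤ ‖ζ‖ * (3 * Real.exp (-2 * ζ.im) / a ^ 2) := by
  set z := Complex.exp (2 * Complex.I * ζ) with hz
  have hzn : ‖z‖ = Real.exp (-2 * ζ.im) := by
    rw [hz, Complex.norm_exp]
    simp
  have hz2 : ‖z‖ ≤ 1 / 2 := by
    have := Real.add_one_le_exp (2 * ζ.im)
    rw [hzn, neg_mul, Real.exp_neg, inv_le_comm₀ (by positivity) (by positivity)]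
    linarith
  have hlog := Complex.norm_log_one_add_half_le_self hz2
  have hz1 : 1 + z ≠ 0 := by
    intro h
    rw [eq_neg_of_add_eq_zero_right h] at hz2
    norm_num at hz2
  rw [stripIntegrand, logResolvent, stripFun, ← hz, if_neg hz1, norm_mul]
  gcongr
  have hsub : a / 2 ≤ ‖Complex.log (1 + z) - a‖ := by
    have := norm_sub_norm_le (a : ℂ) (Complex.log (1 + z))
    rw [Complex.norm_real, Real.norm_of_nonneg ha.le, norm_sub_rev] at this
    linarith
  have hne : Complex.log (1 + z) - a ≠ 0 := norm_pos_iff.1 (by linarith)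
  have hac : (a : ℂ) ≠ 0 := by exact_mod_cast ha.ne'
  have e : (Complex.log (1 + z) - a)⁻¹ + (a : ℂ)⁻¹ =
      Complex.log (1 + z) / ((Complex.log (1 + z) - a) * a) := by
    field_simp
    ring
  have e2 : 3 * Real.exp (-2 * ζ.im) / a ^ 2 = (3 / 2 * ‖z‖) / (a / 2 * a) := by
    rw [hzn]
    field_simp
  rw [e, e2, norm_div, norm_mul, Complex.norm_real, Real.norm_of_nonneg ha.le]
  gcongr

/-! ### A simple pole on the contour. -/

theorem exists_tendsto_div_sub_simple_pole {N f : ℂ → ℂ} {p : ℂ} (hN : AnalyticAt ℂ N p)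
    (hf : AnalyticAt ℂ f p) (hp : f p = 0) (hd : deriv f p ≠ 0) :
    ∃ l, Tendsto (fun z => N z / f z - (N p / deriv f p) / (z - p)) (𝓝[≠] p) (𝓝 l) := by
  obtain ⟨q, hq⟩ := hf
  have hg : AnalyticAt ℂ (dslope f p) p := hq.has_fpower_series_dslope_fslope.analyticAt
  have hgp : dslope f p p = deriv f p := dslope_same f p
  have hh : AnalyticAt ℂ (fun z => N z / dslope f p z) p := hN.div hg (by rwa [hgp])
  -- The difference is the slope at `p` of `N / dslope f p`, so its limit is a derivative.
  refine ⟨_, (hasDerivAt_iff_tendsto_slope.1 hh.differentiableAt.hasDerivAt).congr' ?_⟩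
  filter_upwards [self_mem_nhdsWithin] with z hz
  have hz : z - p ≠ 0 := sub_ne_zero.2 hz
  have e : f z = (z - p) * dslope f p z := by
    have := sub_smul_dslope f p z
    rw [hp, sub_zero, smul_eq_mul] at this
    exact this.symm
  rw [slope_def_field, hgp, e, sub_div, mul_comm, div_div]

theorem integral_inv_add_ofReal_mul {s q : ℂ} {b c : ℝ}
    (h : ∀ x ∈ uIcc b c, x * s + q ∈ Complex.slitPlane) :
    ∫ x in b..c, s * (x * s + q)⁻¹ = Complex.log (c * s + q) - Complex.log (b * s + q) := by
  refine intervalIntegral.integral_eq_sub_of_hasDerivAt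
    (f := fun x : ℝ => Complex.log (x * s + q)) (fun x hx => ?_) ?_
  · have h1 : HasDerivAt (fun x : ℝ => (x : ℂ) * s + q) s x := by
      simpa using ((Complex.ofRealCLM.hasDerivAt (x := x)).mul_const s).add_const q
    simpa [div_eq_mul_inv] using h1.clog_real (h x hx)
  · refine ContinuousOn.intervalIntegrable (continuousOn_const.mul (ContinuousOn.inv₀ ?_ ?_))
    · fun_prop
    · exact fun x hx => Complex.slitPlane_ne_zero (h x hx)

/-- The integral of `1 / (ζ - i y₀)` over the bottom, right and top sides of a rectangle whose
left side contains `i y₀`. -/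
theorem three_sides_integral_inv_sub {b Y y₀ : ℝ} (hb : 0 < b) (h0 : 0 < y₀) (hY : y₀ < Y) :
    (∫ x in (0 : ℝ)..b, ((x : ℂ) + (0 : ℝ) * Complex.I - y₀ * Complex.I)⁻¹) -
      (∫ x in (0 : ℝ)..b, ((x : ℂ) + Y * Complex.I - y₀ * Complex.I)⁻¹) +
      Complex.I * ∫ y in (0 : ℝ)..Y, ((b : ℂ) + y * Complex.I - y₀ * Complex.I)⁻¹ =
    (Real.log (Y - y₀) - Real.log y₀ : ℝ) + Real.pi * Complex.I := by
  -- The three sides avoid the cut of the principal logarithm, so the integrals telescope; the half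
  -- turn from `-i` to `i` gives `πi`.
  have h1 := integral_inv_add_ofReal_mul (s := 1) (q := -(y₀ : ℂ) * Complex.I) (b := 0) (c := b)
    (fun x _ => Or.inr (by simp [h0.ne']))
  have h2 := integral_inv_add_ofReal_mul (s := 1) (q := ((Y - y₀ : ℝ) : ℂ) * Complex.I)
    (b := 0) (c := b) (fun x _ => Or.inr (by simp; linarith))
  have h3 := integral_inv_add_ofReal_mul (s := Complex.I) (q := (b : ℂ) - y₀ * Complex.I)
    (b := 0) (c := Y) (fun x _ => Or.inl (by simpa using hb))
  rw [intervalIntegral.integral_const_mul] at h3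
  have e1 : ∀ x : ℝ, (x : ℂ) + (0 : ℝ) * Complex.I - y₀ * Complex.I =
      x * 1 + -(y₀ : ℂ) * Complex.I := fun x => by push_cast; ring
  have e2 : ∀ x : ℝ, (x : ℂ) + Y * Complex.I - y₀ * Complex.I =
      x * 1 + ((Y - y₀ : ℝ) : ℂ) * Complex.I := fun x => by push_cast; ring
  have e3 : ∀ y : ℝ, (b : ℂ) + y * Complex.I - y₀ * Complex.I =
      y * Complex.I + (b - y₀ * Complex.I) := fun x => by ring
  simp only [one_mul] at h1 h2
  simp only [e1, e2, e3]
  rw [h1, h2, h3]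
  have c1 : (b : ℂ) * 1 + -(y₀ : ℂ) * Complex.I =
      ((0 : ℝ) : ℂ) * Complex.I + (b - y₀ * Complex.I) := by push_cast; ring
  have c2 : (b : ℂ) * 1 + ((Y - y₀ : ℝ) : ℂ) * Complex.I =
      Y * Complex.I + (b - y₀ * Complex.I) := by push_cast; ring
  have l1 : Complex.log (((0 : ℝ) : ℂ) * 1 + ((Y - y₀ : ℝ) : ℂ) * Complex.I) =
      Real.log (Y - y₀) + Real.pi / 2 * Complex.I := by
    rw [Complex.ofReal_zero, zero_mul, zero_add, Complex.log_ofReal_mul (by linarith)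
      Complex.I_ne_zero, Complex.log_I]
  have l2 : Complex.log (((0 : ℝ) : ℂ) * 1 + -(y₀ : ℂ) * Complex.I) =
      Real.log y₀ - Real.pi / 2 * Complex.I := by
    rw [Complex.ofReal_zero, zero_mul, zero_add, neg_mul, ← mul_neg,
      Complex.log_ofReal_mul h0 (by simp), Complex.log_neg_I]
    ring
  rw [c1, c2, l1, l2]
  push_cast
  ring

/-! ### Cauchy's theorem on the rectangle and the limit `Y → ∞`. -/

theorem integral_stripIntegrand_identity {a Y y₀ c : ℝ} (ha : 0 < a) (h0 : 0 < y₀) (hY : y₀ < Y)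
    {G : ℂ → ℂ} (hG : ContinuousOn G (Icc 0 (Real.pi / 2) ×ℂ Icc 0 Y))
    (hGF : ∀ ζ : ℂ, ζ ≠ y₀ * Complex.I → G ζ = stripIntegrand a ζ - c * (ζ - y₀ * Complex.I)⁻¹) :
    -(∫ x in (0 : ℝ)..(Real.pi / 2), oloaIntegrand a x)
      - (∫ x in (0 : ℝ)..(Real.pi / 2), stripIntegrand a (x + Y * Complex.I)).im
      + Real.pi / 2 * ∫ y in (0 : ℝ)..Y, (a⁻¹ - (a + edgeLog y)⁻¹) = c * Real.pi := by
  have hpi : 0 < Real.pi / 2 := by positivity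
  have hY0 : 0 < Y := h0.trans hY
  have hC := Complex.integral_boundary_rect_eq_zero_of_differentiable_on_off_countable G 0
    ((Real.pi / 2 : ℝ) + Y * Complex.I) ∅ countable_empty
  have hre : ((Real.pi / 2 : ℝ) + Y * Complex.I : ℂ).re = Real.pi / 2 := by simp
  have him : ((Real.pi / 2 : ℝ) + Y * Complex.I : ℂ).im = Y := by simp
  rw [hre, him, Complex.zero_re, Complex.zero_im, uIcc_of_le hpi.le, uIcc_of_le hY0.le,
    min_eq_left hpi.le, max_eq_right hpi.le, min_eq_left hY0.le, max_eq_right hY0.le] at hC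
  have hC := hC hG ?_
  swap
  · rintro ζ ⟨⟨⟨h1, h2⟩, h3, h4⟩, -⟩
    have hζ : ζ ≠ y₀ * Complex.I := by
      rintro rfl
      simp at h1
    have hd : DifferentiableAt ℂ
        (fun ζ => stripIntegrand a ζ - c * (ζ - y₀ * Complex.I)⁻¹) ζ := by
      refine (differentiableAt_stripIntegrand (Or.inr (stripFun_im_pos h1 h2).ne')
        (log_stripFun_ne_of_re_pos ha h1 h2.le h3.le)).sub ?_
      have hs : DifferentiableAt ℂ (fun ζ : ℂ => ζ - y₀ * Complex.I) ζ := by fun_prop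
      exact (hs.fun_inv (sub_ne_zero.2 hζ)).const_mul _
    refine hd.congr_of_eventuallyEq ?_
    filter_upwards [isOpen_ne.mem_nhds hζ] with v hv using hGF v hv
  -- integrability of `G` and of the polar part along a side, and hence of the integrand
  have hGh : ∀ t ∈ Icc 0 Y, IntervalIntegrable (fun x : ℝ => G (x + t * Complex.I))
      MeasureTheory.volume 0 (Real.pi / 2) := by
    intro t ht
    refine ContinuousOn.intervalIntegrable (hG.comp (by fun_prop) fun x hx => ?_)
    rw [uIcc_of_le hpi.le] at hx
    exact ⟨by simpa using hx, by simpa using ht⟩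
  have hGv : ∀ t ∈ Icc 0 (Real.pi / 2), IntervalIntegrable (fun y : ℝ => G (t + y * Complex.I))
      MeasureTheory.volume 0 Y := by
    intro t ht
    refine ContinuousOn.intervalIntegrable (hG.comp (by fun_prop) fun x hx => ?_)
    rw [uIcc_of_le hY0.le] at hx
    exact ⟨by simpa using ht, by simpa using hx⟩
  have hPh : ∀ t : ℝ, t ≠ y₀ → Continuous
      (fun x : ℝ => (c : ℂ) * ((x : ℂ) + t * Complex.I - y₀ * Complex.I)⁻¹) := by
    intro t ht
    refine continuous_const.mul (Continuous.inv₀ (by fun_prop) fun x h => ht ?_)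
    simpa [sub_eq_zero] using congrArg Complex.im h
  have hPv : Continuous
      (fun y : ℝ => (c : ℂ) * (((Real.pi / 2 : ℝ) : ℂ) + y * Complex.I - y₀ * Complex.I)⁻¹) := by
    refine continuous_const.mul (Continuous.inv₀ (by fun_prop) fun x h => hpi.ne' ?_)
    simpa [sub_eq_zero] using congrArg Complex.re h
  have hFh : ∀ t : ℝ, t ≠ y₀ → ∀ x : ℝ, stripIntegrand a (x + t * Complex.I) =
      G (x + t * Complex.I) + c * ((x : ℂ) + t * Complex.I - y₀ * Complex.I)⁻¹ := by
    intro t ht x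
    rw [hGF _ fun h => ht (by simpa using congrArg Complex.im h)]
    ring
  have hFv : ∀ y : ℝ, stripIntegrand a ((Real.pi / 2 : ℝ) + y * Complex.I) =
      G ((Real.pi / 2 : ℝ) + y * Complex.I) +
        c * (((Real.pi / 2 : ℝ) : ℂ) + y * Complex.I - y₀ * Complex.I)⁻¹ := by
    intro y
    rw [hGF _ fun h => hpi.ne' (by simpa using congrArg Complex.re h)]
    ring
  have hFhi : ∀ t ∈ Icc 0 Y, t ≠ y₀ → IntervalIntegrable
      (fun x : ℝ => stripIntegrand a (x + t * Complex.I)) MeasureTheory.volume 0 (Real.pi / 2) := by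
    intro t ht ht'
    simp only [hFh t ht']
    exact (hGh t ht).add ((hPh t ht').intervalIntegrable _ _)
  have hFvi : IntervalIntegrable
      (fun y : ℝ => stripIntegrand a ((Real.pi / 2 : ℝ) + y * Complex.I))
      MeasureTheory.volume 0 Y := by
    simp only [hFv]
    exact (hGv _ ⟨hpi.le, le_rfl⟩).add (hPv.intervalIntegrable _ _)
  have m0 : (0 : ℝ) ∈ Icc 0 Y := ⟨le_rfl, hY0.le⟩
  have mY : Y ∈ Icc 0 Y := ⟨hY0.le, le_rfl⟩
  have hB : ∀ t ∈ Icc 0 Y, t ≠ y₀ →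
      ∫ x in (0 : ℝ)..(Real.pi / 2), stripIntegrand a (x + t * Complex.I) =
      (∫ x in (0 : ℝ)..(Real.pi / 2), G (x + t * Complex.I)) +
        c * ∫ x in (0 : ℝ)..(Real.pi / 2), ((x : ℂ) + t * Complex.I - y₀ * Complex.I)⁻¹ := by
    intro t ht ht'
    simp only [hFh t ht']
    rw [intervalIntegral.integral_add (hGh t ht) ((hPh t ht').intervalIntegrable _ _),
      intervalIntegral.integral_const_mul]
  have hR : ∫ y in (0 : ℝ)..Y, stripIntegrand a ((Real.pi / 2 : ℝ) + y * Complex.I) =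
      (∫ y in (0 : ℝ)..Y, G ((Real.pi / 2 : ℝ) + y * Complex.I)) +
        c * ∫ y in (0 : ℝ)..Y,
          (((Real.pi / 2 : ℝ) : ℂ) + y * Complex.I - y₀ * Complex.I)⁻¹ := by
    simp only [hFv]
    rw [intervalIntegral.integral_add (hGv _ ⟨hpi.le, le_rfl⟩) (hPv.intervalIntegrable _ _),
      intervalIntegral.integral_const_mul]
  have hP := three_sides_integral_inv_sub hpi h0 hY
  have hsum : (∫ x in (0 : ℝ)..(Real.pi / 2), stripIntegrand a (x + (0 : ℝ) * Complex.I)) -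
      (∫ x in (0 : ℝ)..(Real.pi / 2), stripIntegrand a (x + Y * Complex.I)) +
      Complex.I * (∫ y in (0 : ℝ)..Y, stripIntegrand a ((Real.pi / 2 : ℝ) + y * Complex.I)) -
      Complex.I * (∫ y in (0 : ℝ)..Y, G ((0 : ℝ) + y * Complex.I)) =
      c * ((Real.log (Y - y₀) - Real.log y₀ : ℝ) + Real.pi * Complex.I) := by
    rw [hB 0 m0 h0.ne, hB Y mY hY.ne', hR, ← hP]
    simp only [smul_eq_mul] at hC
    linear_combination hC
  -- On the imaginary axis both `F` and, since `c` is real, the polar term are purely imaginary off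
  -- the pole.
  have hleft : (∫ y in (0 : ℝ)..Y, G ((0 : ℝ) + y * Complex.I)).re = 0 := by
    have := Complex.reCLM.intervalIntegral_comp_comm (hGv 0 ⟨le_rfl, hpi.le⟩)
    rw [Complex.reCLM_apply] at this
    rw [← this]
    refine intervalIntegral.integral_zero_ae ?_
    filter_upwards [MeasureTheory.Measure.ae_ne MeasureTheory.volume y₀] with y hy _
    rw [Complex.reCLM_apply, Complex.ofReal_zero, zero_add,
      hGF _ fun h => hy (by simpa using congrArg Complex.im h), Complex.sub_re,
      stripIntegrand_mul_I_re, Complex.re_ofReal_mul, ← sub_mul, Complex.inv_re]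
    simp
  have hbot : (∫ x in (0 : ℝ)..(Real.pi / 2), stripIntegrand a (x + (0 : ℝ) * Complex.I)).im =
      -(∫ x in (0 : ℝ)..(Real.pi / 2), oloaIntegrand a x) := by
    have := Complex.imCLM.intervalIntegral_comp_comm (hFhi 0 m0 h0.ne)
    rw [Complex.imCLM_apply] at this
    rw [← this, ← intervalIntegral.integral_neg]
    refine intervalIntegral.integral_congr_ae ?_
    filter_upwards [MeasureTheory.Measure.ae_ne MeasureTheory.volume (Real.pi / 2)] with x hx hx'
    rw [uIoc_of_le hpi.le] at hx'
    simpa using stripIntegrand_ofReal_im (a := a) hx'.1 (lt_of_le_of_ne hx'.2 hx)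
  have hright : (∫ y in (0 : ℝ)..Y, stripIntegrand a ((Real.pi / 2 : ℝ) + y * Complex.I)).re =
      Real.pi / 2 * ∫ y in (0 : ℝ)..Y, (a⁻¹ - (a + edgeLog y)⁻¹) := by
    have := Complex.reCLM.intervalIntegral_comp_comm hFvi
    rw [Complex.reCLM_apply] at this
    rw [← this, ← intervalIntegral.integral_const_mul]
    refine intervalIntegral.integral_congr_ae (Eventually.of_forall fun y hy => ?_)
    rw [uIoc_of_le hY0.le] at hy
    exact stripIntegrand_half_pi_add_mul_I_re a hy.1
  -- The logarithms in the polar contribution are real and disappear, leaving `cπ`.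
  have := congrArg Complex.im hsum
  simp only [Complex.sub_im, Complex.add_im, Complex.I_mul_im, hleft, hbot, hright,
    Complex.im_ofReal_mul, Complex.I_im, mul_one, sub_zero, Complex.ofReal_im, zero_add] at this
  exact this

theorem tendsto_integral_stripIntegrand_top {a : ℝ} (ha : 0 < a) :
    Tendsto (fun Y : ℝ => (∫ x in (0 : ℝ)..(Real.pi / 2),
      stripIntegrand a (x + Y * Complex.I)).im) atTop (𝓝 0) := by
  have hpi : 0 < Real.pi / 2 := by positivity
  have hexp : Tendsto (fun Y : ℝ => Real.exp (-2 * Y)) atTop (𝓝 0) :=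
    Real.tendsto_exp_atBot.comp (tendsto_id.const_mul_atTop_of_neg (by norm_num))
  have hYexp : Tendsto (fun Y : ℝ => Y * Real.exp (-2 * Y)) atTop (𝓝 0) := by
    simpa using tendsto_rpow_mul_exp_neg_mul_atTop_nhds_zero 1 2 two_pos
  have hlim : Tendsto (fun Y : ℝ => 3 / a ^ 2 * (Real.pi / 2) *
      (Real.pi / 2 * Real.exp (-2 * Y) + Y * Real.exp (-2 * Y))) atTop (𝓝 0) := by
    simpa using ((hexp.const_mul (Real.pi / 2)).add hYexp).const_mul (3 / a ^ 2 * (Real.pi / 2))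
  refine squeeze_zero_norm' ?_ hlim
  have hsmall : ∀ᶠ Y : ℝ in atTop, 3 * Real.exp (-2 * Y) < a := by
    have := hexp.const_mul 3
    rw [mul_zero] at this
    exact this.eventually (gt_mem_nhds ha)
  filter_upwards [hsmall, eventually_ge_atTop 1] with Y hY1 hY2
  have hb : ∀ x ∈ uIoc 0 (Real.pi / 2), ‖stripIntegrand a (x + Y * Complex.I)‖ ≤
      (Real.pi / 2 + Y) * (3 * Real.exp (-2 * Y) / a ^ 2) := by
    intro x hx
    rw [uIoc_of_le hpi.le] at hx
    have him : ((x : ℂ) + Y * Complex.I).im = Y := by simp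
    have h1 := norm_stripIntegrand_le (ζ := x + Y * Complex.I) ha (by rwa [him])
      (by rw [him]; exact hY1.le)
    rw [him] at h1
    refine h1.trans ?_
    gcongr
    refine (norm_add_le _ _).trans ?_
    rw [Complex.norm_real, norm_mul, Complex.norm_real, Complex.norm_I, mul_one,
      Real.norm_of_nonneg hx.1.le, Real.norm_of_nonneg (by linarith)]
    linarith [hx.2]
  have h2 := intervalIntegral.norm_integral_le_of_norm_le_const hb
  rw [sub_zero, abs_of_pos hpi] at h2
  refine (Complex.abs_im_le_norm _).trans (h2.trans (le_of_eq ?_))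
  ring

theorem oloaM_eq_regularPart_sub {a y₀ c : ℝ} (ha : 0 < a) (h0 : 0 < y₀) {G : ℂ → ℂ}
    (hG : ∀ ζ : ℂ, 0 ≤ ζ.re → ζ.re ≤ Real.pi / 2 → 0 ≤ ζ.im → ContinuousAt G ζ)
    (hGF : ∀ ζ : ℂ, ζ ≠ y₀ * Complex.I → G ζ = stripIntegrand a ζ - c * (ζ - y₀ * Complex.I)⁻¹) :
    oloaM a = regularPart a - 4 * c := by
  have hlim := (((tendsto_integral_stripIntegrand_top ha).const_sub
    (-(∫ x in (0 : ℝ)..(Real.pi / 2), oloaIntegrand a x))).add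
    ((MeasureTheory.intervalIntegral_tendsto_integral_Ioi 0
      (integrableOn_inv_sub_inv_add_edgeLog ha) tendsto_id).const_mul (Real.pi / 2)))
  have heq := tendsto_nhds_unique (hlim.congr' ?_) (tendsto_const_nhds (x := c * Real.pi))
  · rw [oloaM, regularPart]
    have e : ∫ x in (0 : ℝ)..(Real.pi / 2), oloaIntegrand a x =
        Real.pi / 2 * (∫ y in Ioi (0 : ℝ), (a⁻¹ - (a + edgeLog y)⁻¹)) - c * Real.pi := by
      linarith
    rw [e]
    field_simp
    ring
  · filter_upwards [eventually_gt_atTop y₀] with Y hY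
    refine integral_stripIntegrand_identity ha h0 hY (fun ζ hζ => ?_) hGF
    exact (hG ζ hζ.1.1 hζ.1.2 hζ.2.1).continuousWithinAt

/-! ### Closed forms on the two sides of `log 2`. -/

theorem oloaM_eq_of_gt {a : ℝ} (ha : Real.log 2 < a) : oloaM a = regularPart a := by
  have ha0 : 0 < a := (Real.log_pos one_lt_two).trans ha
  -- There is no pole, so `c = 0` and the choice of `y₀` is immaterial.
  have := oloaM_eq_regularPart_sub (y₀ := 1) (c := 0) (G := stripIntegrand a) ha0 one_pos
    (fun ζ h0 h1 h2 => continuousAt_stripIntegrand ha0 h0 h1 h2 (Or.inl ?_)) (by simp)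
  · simpa using this
  · have h3 : Real.exp (-2 * ζ.im) ≤ 1 := by simpa using h2
    have := Real.log_le_log (x := 1 + Real.exp (-2 * ζ.im)) (y := 2) (by positivity) (by linarith)
    linarith

/-- The contribution to `M` of the pole inside the contour, present for `a < log 2`. -/
noncomputable def polarPart (a : ℝ) : ℝ :=
  Real.log (Real.exp a - 1) * (Real.exp a / (Real.exp a - 1))

theorem oloaM_eq_of_lt {a : ℝ} (ha0 : 0 < a) (ha : a < Real.log 2) :
    oloaM a = regularPart a + polarPart a := by
  have hE1 : 1 < Real.exp a := by simpa using ha0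
  have hE2 : Real.exp a < 2 := (Real.lt_log_iff_exp_lt two_pos).1 ha
  set z₀ := Real.exp a - 1 with hz₀
  have hz0 : 0 < z₀ := by linarith
  -- The solution of `1 + e^{-2y₀} = e^a`; it is positive because `e^a < 2`.
  set y₀ := -Real.log z₀ / 2 with hy₀
  have hy0 : 0 < y₀ := by
    have := Real.log_neg hz0 (by linarith)
    rw [hy₀]
    linarith
  have hexp : Real.exp (-2 * y₀) = z₀ := by
    rw [hy₀, ← Real.exp_log hz0]
    congr 1
    rw [Real.exp_log hz0]
    ring
  set p : ℂ := y₀ * Complex.I with hp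
  -- The residue of `F` at `p`: `p` divided by the derivative `2i z₀ / e^a` of `log (1 + e^{2iζ}) -
  -- a`.
  set c : ℝ := y₀ * Real.exp a / (2 * z₀) with hc
  have hsp : stripFun p = Real.exp a := by
    rw [hp, stripFun_mul_I, hexp, hz₀]
    congr 1
    ring
  have hsl : stripFun p ∈ Complex.slitPlane := by
    rw [hsp]
    exact Complex.ofReal_mem_slitPlane.2 (Real.exp_pos a)
  have hlp : Complex.log (stripFun p) - a = 0 := by
    rw [hsp, ← Complex.ofReal_log (Real.exp_pos a).le, Real.log_exp, sub_self]
  have hder : HasDerivAt (fun ζ => Complex.log (stripFun ζ) - a)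
      (2 * Complex.I * z₀ / Real.exp a) p := by
    have h1 : HasDerivAt stripFun (2 * Complex.I * z₀) p := by
      have h2 : HasDerivAt (fun ζ : ℂ => 2 * Complex.I * ζ) (2 * Complex.I) p := by
        simpa using (hasDerivAt_id p).const_mul (2 * Complex.I)
      have h3 : Complex.exp (2 * Complex.I * p) = z₀ := by
        have : stripFun p - 1 = z₀ := by rw [hsp, hz₀]; push_cast; rfl
        rw [← this, stripFun]
        ring
      refine (h2.cexp.const_add 1).congr_deriv ?_
      rw [h3]
      ring
    simpa [hsp] using (h1.clog hsl).sub_const (a : ℂ)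
  have hz0c : (z₀ : ℂ) ≠ 0 := by exact_mod_cast hz0.ne'
  have hEc : ((Real.exp a : ℝ) : ℂ) ≠ 0 := by exact_mod_cast (Real.exp_pos a).ne'
  have hcp : p / deriv (fun ζ => Complex.log (stripFun ζ) - a) p = c := by
    rw [hder.deriv, hp, hc]
    push_cast
    field_simp
  have hana : AnalyticAt ℂ (fun ζ => Complex.log (stripFun ζ) - a) p :=
    ((differentiable_stripFun.analyticAt p).clog hsl).sub analyticAt_const
  obtain ⟨l, hl⟩ := exists_tendsto_div_sub_simple_pole analyticAt_id hana hlp (by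
    rw [hder.deriv]
    exact div_ne_zero (mul_ne_zero (mul_ne_zero two_ne_zero Complex.I_ne_zero) hz0c) hEc)
  simp only [id, hcp] at hl
  have hF : Tendsto (fun ζ => stripIntegrand a ζ - c * (ζ - p)⁻¹) (𝓝[≠] p)
      (𝓝 (l + p * (a : ℂ)⁻¹)) := by
    have h1 : Tendsto (fun ζ : ℂ => ζ * (a : ℂ)⁻¹) (𝓝[≠] p) (𝓝 (p * (a : ℂ)⁻¹)) :=
      ((continuous_id.mul continuous_const).tendsto p).mono_left nhdsWithin_le_nhds
    refine (hl.add h1).congr' ?_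
    have h2 : ∀ᶠ ζ in 𝓝[≠] p, stripFun ζ ≠ 0 :=
      nhdsWithin_le_nhds (differentiable_stripFun.continuous.continuousAt.eventually_ne
        (Complex.slitPlane_ne_zero hsl))
    filter_upwards [h2] with ζ hζ
    rw [stripIntegrand, logResolvent, if_neg hζ]
    ring
  have hres := oloaM_eq_regularPart_sub (c := c)
    (G := Function.update (fun ζ => stripIntegrand a ζ - c * (ζ - p)⁻¹) p (l + p * (a : ℂ)⁻¹))
    ha0 hy0 (fun ζ h0 h1 h2 => ?_) (fun ζ hζ => Function.update_of_ne hζ _ _)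
  · rw [hres, polarPart, ← hz₀, hc, hy₀]
    field_simp
    ring
  · by_cases hζ : ζ = p
    · rw [hζ, continuousAt_update_same]
      exact hF
    · rw [continuousAt_update_of_ne hζ]
      have h3 : ContinuousAt (fun ζ : ℂ => ζ - p) ζ := by fun_prop
      refine (continuousAt_stripIntegrand ha0 h0 h1 h2 ?_).sub
        (continuousAt_const.mul (h3.inv₀ (sub_ne_zero.2 hζ)))
      rcases h0.eq_or_lt with h0 | h0
      · left
        intro h
        apply hζ
        have h4 : Real.exp (-2 * ζ.im) = Real.exp (-2 * y₀) := by
          rw [hexp, hz₀, ← h, Real.exp_log (by positivity)]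
          ring
        have h5 := Real.exp_injective h4
        apply Complex.ext
        · simp [hp, ← h0]
        · simp [hp]
          linarith
      · exact Or.inr h0

theorem analyticAt_polarPart {a : ℝ} (ha : 0 < a) : AnalyticAt ℝ polarPart a := by
  have hE : 0 < Real.exp a - 1 := by simpa using ha
  have h1 : AnalyticAt ℝ (fun a => Real.exp a - 1) a := analyticAt_rexp.sub analyticAt_const
  exact (h1.log hE).mul (analyticAt_rexp.div h1 hE.ne')

theorem hasDerivAt_polarPart_log_two : HasDerivAt polarPart 4 (Real.log 2) := by
  have he : Real.exp (Real.log 2) = 2 := Real.exp_log two_pos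
  have h0 : Real.exp (Real.log 2) - 1 ≠ 0 := by rw [he]; norm_num
  have h1 : HasDerivAt (fun a => Real.exp a - 1) (Real.exp (Real.log 2)) (Real.log 2) :=
    (Real.hasDerivAt_exp _).sub_const 1
  -- At `log 2` the factor `log (e^a - 1)` vanishes, so only its derivative `2` times the other
  -- factor `2` survives.
  refine ((h1.log h0).fun_mul ((Real.hasDerivAt_exp _).fun_div h1 h0)).congr_deriv ?_
  rw [he]
  norm_num

/-! ### The jump of the derivative. -/

theorem mainTheorem3 :
    ContinuousAt oloaM (Real.log 2) ∧
    AnalyticOnNhd ℝ oloaM (Ioo 0 (Real.log 2)) ∧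
    AnalyticOnNhd ℝ oloaM (Ioi (Real.log 2)) ∧
    ∃ dl dr : ℝ,
      Tendsto (deriv oloaM) (𝓝[<] (Real.log 2)) (𝓝 dl) ∧
      Tendsto (deriv oloaM) (𝓝[>] (Real.log 2)) (𝓝 dr) ∧
      HasDerivWithinAt oloaM dl (Iic (Real.log 2)) (Real.log 2) ∧
      HasDerivWithinAt oloaM dr (Ici (Real.log 2)) (Real.log 2) ∧
      dl - dr = 4 := by
  have hpos : 0 < Real.log 2 := Real.log_pos one_lt_two
  have hcont := continuous_oloaM.continuousAt (x := Real.log 2)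
  have hE := analyticAt_regularPart hpos
  have hsum := hE.add (analyticAt_polarPart hpos)
  have hl : ∀ a ∈ Ioo 0 (Real.log 2), oloaM =ᶠ[𝓝 a] regularPart + polarPart := fun a ha => by
    filter_upwards [Ioo_mem_nhds ha.1 ha.2] with b hb using oloaM_eq_of_lt hb.1 hb.2
  have hr : ∀ a ∈ Ioi (Real.log 2), oloaM =ᶠ[𝓝 a] regularPart := fun a ha => by
    filter_upwards [Ioi_mem_nhds ha] with b hb using oloaM_eq_of_gt hb
  have hdl : Tendsto (deriv oloaM) (𝓝[<] (Real.log 2))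
      (𝓝 (deriv (regularPart + polarPart) (Real.log 2))) := by
    refine (hsum.deriv.continuousAt.tendsto.mono_left nhdsWithin_le_nhds).congr' ?_
    filter_upwards [Ioo_mem_nhdsLT hpos] with a ha using (hl a ha).deriv_eq.symm
  have hdr : Tendsto (deriv oloaM) (𝓝[>] (Real.log 2)) (𝓝 (deriv regularPart (Real.log 2))) := by
    refine (hE.deriv.continuousAt.tendsto.mono_left nhdsWithin_le_nhds).congr' ?_
    filter_upwards [self_mem_nhdsWithin] with a ha using (hr a ha).deriv_eq.symm
  refine ⟨hcont, fun a ha => ?_, fun a ha => ?_, _, _, hdl, hdr, ?_, ?_, ?_⟩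
  · exact ((analyticAt_regularPart ha.1).add (analyticAt_polarPart ha.1)).congr (hl a ha).symm
  · exact (analyticAt_regularPart (hpos.trans ha)).congr (hr a ha).symm
  -- The closed forms do not cover `log 2` itself; continuity there and the limit of the derivative
  -- give the one-sided derivative.
  · refine hasDerivWithinAt_Iic_of_tendsto_deriv (s := Ioo 0 (Real.log 2)) (fun a ha => ?_)
      hcont.continuousWithinAt (Ioo_mem_nhdsLT hpos) hdl
    exact (((analyticAt_regularPart ha.1).add
      (analyticAt_polarPart ha.1)).congr (hl a ha).symm).differentiableAt.differentiableWithinAt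
  · refine hasDerivWithinAt_Ici_of_tendsto_deriv (s := Ioi (Real.log 2)) (fun a ha => ?_)
      hcont.continuousWithinAt self_mem_nhdsWithin hdr
    exact ((analyticAt_regularPart (hpos.trans ha)).congr
      (hr a ha).symm).differentiableAt.differentiableWithinAt
  · rw [deriv_add hE.differentiableAt hasDerivAt_polarPart_log_two.differentiableAt,
      hasDerivAt_polarPart_log_two.deriv]
    ring
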